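/- Let $N\ge 1$ be an integer, and for $\Omega\subseteq\mathbb{R}^N$ open let $L^p(\Omega)$, $H^1_{\mathrm{loc}}(\Omega)$, $H^1_0(\Omega)$ denote spaces of complex-valued functions, where $H^1_0(\Omega)$ is the closure of $\mathscr{D}(\Omega)=C_c^\infty(\Omega;\mathbb{C})$ in $H^1(\Omega)$. Let $\mathbb{A}=\mathbb{C}\setminus\{z:\operatorname{Re}z=0,\ \operatorname{Im}z\le 0\}$ and $\mathbb{B}=\mathbb{A}\cup\{0\}$. For $0<m<1$, $a,b\in\mathbb{C}$ and $F\in L^1_{\mathrm{loc}}(\Omega)$, a global weak solution of $$-i\Delta u+a|u|^{-(1-m)}u+bu=F\ \text{ in }\Omega,\qquad u=0\ \text{ on }\partial\Omega,$$ is a function $u\in H^1_{\mathrm{loc}}(\Omega)$ which satisfies the equation in $\mathscr{D}'(\Omega)$ and belongs to $H^1_0(\Omega)\cap L^{m+1}(\Omega)$; here $|z|^{-(1-m)}z$ is understood to be $0$ at $z=0$. **Theorem 5.1.** For each integer $N\ge1$ and each $m\in(0,1)$ there is a constant $C=C(N,m)>0$, depending only on $N$ and $m$ and continuously on $m$, such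 that the following holds. Let $\Omega\subseteq\mathbb{R}^N$ be a nonempty open set, and let $(a,b)\in\mathbb{C}^2\setminus\{(0,0)\}$ satisfy $$\operatorname{Im}(a)\ge 0\quad\text{and}\quad\Big[\big(a\ne 0\text{ and }\operatorname{Re}(a\bar b)\ge 0\big)\ \text{ or }\ \big(a=0\text{ and }b\in\mathbb{B}\big)\Big].$$ Let $F_1,F_2\in L^1_{\mathrm{loc}}(\Omega)$ with $F_1-F_2\in L^2(\Omega)$, and let $u_1,u_2\in H^1_0(\Omega)\cap L^{m+1}(\Omega)$ be global weak solutions with sources $F_1$ and $F_2$, respectively (and the same $a,b,m$). 1. If $a\ne 0$ and $\operatorname{Re}(a\bar b)>0$, then $$\|u_1-u_2\|_{L^2(\Omega)}\le\frac{|a|}{\operatorname{Re}(a\bar b)}\,\|F_1-F_2\|_{L^2(\Omega)}.$$ 2. If $a=0$, then $$\|u_1-u_2\|_{L^2(\Omega)}\le\frac{1}{b_0}\,\|F_1-F_2\|_{L^2(\Omega)},$$ where $b_0=|\operatorname{Re}(b)|$ if $\operatorname{Re}(b)\ne 0$ and $b_0=\operatorname{Im}(b)$ if $\operatorname{Re}(b)=0$.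 3. If $a\ne 0$, $\operatorname{Re}(a\bar b)=0$ and moreover $u_1,u_2\in L^\infty(\Omega)$, then $$\|u_1-u_2\|_{L^2(\Omega)}\le C\,\frac{\big(\|u_1\|_{L^\infty(\Omega)}+\|u_2\|_{L^\infty(\Omega)}\big)^{1-m}}{|a|}\,\|F_1-F_2\|_{L^2(\Omega)}.$$ -/

import Mathlib

open MeasureTheory TopologicalSpace
open scoped Distributions ENNReal ComplexConjugate

noncomputable section

namespace StationaryNLS

/-- Euclidean space `ℝ^N`. -/
abbrev Space (N : ℕ) : Type := EuclideanSpace ℝ (Fin N)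

variable {N : ℕ}

/-- The classical partial derivative `∂_j f`. -/
def partialDeriv (j : Fin N) (f : Space N → ℂ) (x : Space N) : ℂ :=
  fderiv ℝ f x (EuclideanSpace.single j 1)

/-- Membership in `L^p(Ω; ℂ)` for Lebesgue measure. -/
def MemLpOn (Ω : Opens (Space N)) (p : ℝ≥0∞) (f : Space N → ℂ) : Prop :=
  MemLp f p (volume.restrict (Ω : Set (Space N)))

/-- Membership in `L^p_loc(Ω; ℂ)`: the function is in `L^p(K)` for each compact `K ⊆ Ω`. -/
def MemLpLocOn (Ω : Opens (Space N)) (p : ℝ≥0∞) (f : Space N → ℂ) : Prop :=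
  ∀ K : Set (Space N), IsCompact K → K ⊆ Ω → MemLp f p (volume.restrict K)

/-- The real number `‖f‖_{L^p(Ω)}`; it is only used for `f ∈ L^p(Ω)`. -/
def normLpOn (Ω : Opens (Space N)) (p : ℝ≥0∞) (f : Space N → ℂ) : ℝ :=
  lpNorm f p (volume.restrict (Ω : Set (Space N)))

/-- `g` is the weak partial derivative `∂_j u` in `Ω`:
`∫_Ω u ∂_jφ = - ∫_Ω g φ` for every test function `φ ∈ 𝓓(Ω; ℂ)`. -/
def HasWeakPartial (Ω : Opens (Space N)) (j : Fin N) (u g : Space N → ℂ) : Prop :=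
  ∀ φ : 𝓓(Ω, ℂ),
    ∫ x in (Ω : Set (Space N)), u x * partialDeriv j φ x =
      -∫ x in (Ω : Set (Space N)), g x * φ x

/-- `u ∈ H^1_loc(Ω; ℂ)`. -/
def MemH1Loc (Ω : Opens (Space N)) (u : Space N → ℂ) : Prop :=
  MemLpLocOn Ω 2 u ∧
    ∃ G : Fin N → Space N → ℂ, ∀ j, MemLpLocOn Ω 2 (G j) ∧ HasWeakPartial Ω j u (G j)

/-- `u ∈ H^1_0(Ω; ℂ)`, the closure of `𝓓(Ω; ℂ)` in `H^1(Ω; ℂ)`: `u` and its weak gradient are in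
`L²(Ω)`, and there are test functions arbitrarily close to `u` in `L²(Ω)` whose gradients are at the
same time arbitrarily close in `L²(Ω)` to the weak gradient of `u`. -/
def MemH10 (Ω : Opens (Space N)) (u : Space N → ℂ) : Prop :=
  MemLpOn Ω 2 u ∧
    ∃ G : Fin N → Space N → ℂ, (∀ j, MemLpOn Ω 2 (G j) ∧ HasWeakPartial Ω j u (G j)) ∧
      ∀ ε : ℝ, 0 < ε → ∃ φ : 𝓓(Ω, ℂ),
        normLpOn Ω 2 (fun x => u x - φ x) ≤ ε ∧
          ∀ j, normLpOn Ω 2 (fun x => G j x - partialDeriv j φ x) ≤ ε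

/-- The singular nonlinearity `|z|^{-(1-m)} z`. Its value at `z = 0` is `0`. -/
def singularPower (m : ℝ) (z : ℂ) : ℂ := ((‖z‖ ^ (-(1 - m)) : ℝ) : ℂ) * z

/-- `u` is a local weak solution of `-iΔu + a|u|^{-(1-m)}u + bu = F` in `Ω`: `u ∈ H^1_loc(Ω)` and
the equation holds in `𝓓'(Ω)`. The pairing is `⟨T, φ⟩ = Re ∫_Ω T φ̄` for locally integrable `T`, and
`⟨-iΔu, φ⟩ = ⟨-iu, Δφ⟩`. -/
def IsLocalWeakSolution (Ω : Opens (Space N)) (m : ℝ) (a b : ℂ) (F u : Space N → ℂ) : Prop :=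
  MemH1Loc Ω u ∧
    ∀ φ : 𝓓(Ω, ℂ),
      (∫ x in (Ω : Set (Space N)),
          (-Complex.I * u x * conj (Laplacian.laplacian (φ : Space N → ℂ) x) +
            (a * singularPower m (u x) + b * u x) * conj (φ x))).re =
        (∫ x in (Ω : Set (Space N)), F x * conj (φ x)).re

/-- `u` is a global weak solution of `-iΔu + a|u|^{-(1-m)}u + bu = F` in `Ω` with the Dirichlet
condition `u = 0` on `∂Ω`: a local weak solution in `H^1_0(Ω) ∩ L^{m+1}(Ω)`. -/
def IsGlobalWeakSolution (Ω : Opens (Space N)) (m : ℝ) (a b : ℂ) (F u : Space N → ℂ) : Prop :=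
  IsLocalWeakSolution Ω m a b F u ∧ MemH10 Ω u ∧ MemLpOn Ω (ENNReal.ofReal (m + 1)) u

/-- The set `𝔸`: the complex plane without the closed half-line of the numbers `z` with `Re z = 0`
and `Im z ≤ 0`. -/
def setA : Set ℂ := {z : ℂ | z.re = 0 ∧ z.im ≤ 0}ᶜ

/-- The set `𝔹 = 𝔸 ∪ {0}`. -/
def setB : Set ℂ := setA ∪ {0}

/-- The assumption on the coefficients `(a, b)` used for uniqueness. -/
def UniquenessAssumption (a b : ℂ) : Prop :=
  0 ≤ a.im ∧ ((a ≠ 0 ∧ 0 ≤ (a * conj b).re) ∨ (a = 0 ∧ b ∈ setB))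

/-- `b₀ = |Re b|` if `Re b ≠ 0`, and `b₀ = Im b` if `Re b = 0`. -/
def bZero (b : ℂ) : ℝ := if b.re ≠ 0 then |b.re| else b.im

end StationaryNLS

end

/-! Put $w=u_1-u_2$ and $g(z)=|z|^{-(1-m)}z$. Subtract the two equations, pair with $w$, multiply by
a complex number $c$ and take real parts. The Laplacian contributes $\operatorname{Re}(ci)\|\nabla
w\|^2$, which is dropped when it is nonnegative. If the zero-order term satisfies
$\operatorname{Re}(c(a(g(u_1)-g(u_2))+bw)\bar w)\ge\delta|w|^2$, Cauchy-Schwarz yields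
$\delta\|w\|\le|c|\,\|F_1-F_2\|$ (`energy_estimate`, `difference_estimate`).

For $a\ne0$ take $c=\bar a$, so that $\operatorname{Re}(ci)=\operatorname{Im}a\ge0$ and the
zero-order term is $|a|^2\operatorname{Re}((g(u_1)-g(u_2))\bar w)+\operatorname{Re}(a\bar b)|w|^2$.
Monotonicity of $g$ settles the case $\operatorname{Re}(a\bar b)>0$. When $\operatorname{Re}(a\bar
b)=0$, coercivity comes from `singularPower_monotone`, with factor $m/(|u_1|+|u_2|)^{1-m}$; hence
$C=1/m$. For $a=0$, a suitable unimodular $c$ suffices.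

On unbounded $\Omega$, $g(u_i)$ need not lie in $L^2$, so $w$ is not directly an admissible test
function. It is replaced by $\chi_n w$ with cutoffs $\chi_n\to1$, whose gradient terms vanish in the
limit. -/

namespace StationaryNLS

open Filter Topology
open scoped ContDiff

variable {N : ℕ} {Ω : Opens (Space N)}

/-! ### Quantitative monotonicity of the singular power -/

section Monotonicity

/-- Here $r=|z|$, $s=|w|$, $t=\operatorname{Re}(z\bar w)$. Both sides are affine in $t$, so the
endpoints $t=\pm rs$ suffice, where a factor $r\mp s$ splits off. At $t=rs$, weighted AM-GM
$r^{1-m}s^m\le(1-m)r+ms$ gives the bound; at $t=-rs$, subadditivity of $x\mapsto x^m$ does. -/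
theorem singularPower_monotone_real {m r s t : ℝ} (hm0 : 0 < m) (hm1 : m < 1) (hr : 0 ≤ r)
    (hs : 0 ≤ s) (hsr : s ≤ r) (ht : |t| ≤ r * s) :
    m * (r ^ 2 + s ^ 2 - 2 * t) ≤
      (r + s) ^ (1 - m) *
        (r ^ (-(1 - m)) * r ^ 2 + s ^ (-(1 - m)) * s ^ 2 -
          (r ^ (-(1 - m)) + s ^ (-(1 - m))) * t) := by
  have hpow : ∀ x : ℝ, 0 ≤ x → x ^ (-(1 - m)) * x = x ^ m := by
    intro x hx
    rcases hx.eq_or_lt with rfl | hx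
    · simp [Real.zero_rpow hm0.ne']
    · rw [← Real.rpow_add_one hx.ne']
      congr 1
      ring
  have hA := hpow r hr
  have hB := hpow s hs
  set A := r ^ (-(1 - m))
  set B := s ^ (-(1 - m))
  set S := (r + s) ^ (1 - m) with hS
  have hS0 : 0 ≤ S := by positivity
  obtain ⟨ht1, ht2⟩ := abs_le.1 ht
  have hend₁ : m * (r - s) ≤ S * (r ^ m - s ^ m) := by
    have hle : s ^ m ≤ r ^ m := Real.rpow_le_rpow hs hsr hm0.le
    have hamgm := Real.geom_mean_le_arith_mean2_weighted (by linarith : 0 ≤ 1 - m) hm0.le hr hs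
      (by ring)
    have hrr : r ^ (1 - m) * r ^ m = r := by
      rcases hr.eq_or_lt with h | h
      · rw [← h]; simp [Real.zero_rpow hm0.ne']
      · rw [← Real.rpow_add h]; simp
    have hSr : r ^ (1 - m) ≤ S := Real.rpow_le_rpow hr (by linarith) (by linarith)
    calc m * (r - s) ≤ r ^ (1 - m) * (r ^ m - s ^ m) := by rw [mul_sub (r ^ (1 - m)), hrr]; linarith
      _ ≤ S * (r ^ m - s ^ m) := mul_le_mul_of_nonneg_right hSr (by linarith)
  have hend₂ : m * (r + s) ≤ S * (r ^ m + s ^ m) := by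
    have hsub := Real.rpow_add_le_add_rpow hr hs hm0.le hm1.le
    have hSS : S * (r + s) ^ m = r + s := by
      rcases (add_nonneg hr hs).eq_or_lt with h | h
      · rw [← h]; simp [Real.zero_rpow hm0.ne']
      · rw [hS, ← Real.rpow_add h]; simp
    have := mul_le_mul_of_nonneg_left hsub hS0
    nlinarith [add_nonneg hr hs]
  have h₁ : m * (r - s) * (r - s) ≤ S * (A * r - B * s) * (r - s) := by
    rw [hA, hB]; exact mul_le_mul_of_nonneg_right hend₁ (by linarith)
  have h₂ : m * (r + s) * (r + s) ≤ S * (A * r + B * s) * (r + s) := by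
    rw [hA, hB]; exact mul_le_mul_of_nonneg_right hend₂ (by linarith)
  -- The sign of the slope in $t$ decides which endpoint is the worst case.
  rcases le_total 0 (S * (A + B) - 2 * m) with h | h
  · nlinarith [mul_le_mul_of_nonneg_left ht2 h]
  · nlinarith [mul_le_mul_of_nonpos_left ht1 h]

/-- Quantitative monotonicity of `z ↦ |z|^{-(1-m)} z`. -/
theorem singularPower_monotone {m : ℝ} (hm0 : 0 < m) (hm1 : m < 1) (z w : ℂ) :
    m * ‖z - w‖ ^ 2 ≤ (‖z‖ + ‖w‖) ^ (1 - m) *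
      ((singularPower m z - singularPower m w) * conj (z - w)).re := by
  wlog h : ‖w‖ ≤ ‖z‖ generalizing z w
  · have := this w z (le_of_not_ge h)
    rw [norm_sub_rev, add_comm ‖z‖]
    convert this using 3
    rw [← neg_sub w z, ← neg_sub (singularPower m w), map_neg, neg_mul_neg]
  have ht : |(z * conj w).re| ≤ ‖z‖ * ‖w‖ := by
    simpa using Complex.abs_re_le_norm (z * conj w)
  have key := singularPower_monotone_real hm0 hm1 (norm_nonneg z) (norm_nonneg w) h ht
  have e₁ : ‖z - w‖ ^ 2 = ‖z‖ ^ 2 + ‖w‖ ^ 2 - 2 * (z * conj w).re := by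
    rw [Complex.sq_norm, Complex.sq_norm, Complex.sq_norm, Complex.normSq_sub]
  have e₂ : ((singularPower m z - singularPower m w) * conj (z - w)).re =
      ‖z‖ ^ (-(1 - m)) * ‖z‖ ^ 2 + ‖w‖ ^ (-(1 - m)) * ‖w‖ ^ 2 -
        (‖z‖ ^ (-(1 - m)) + ‖w‖ ^ (-(1 - m))) * (z * conj w).re := by
    rw [Complex.sq_norm, Complex.sq_norm]
    simp only [singularPower, map_sub, Complex.mul_re, Complex.sub_re, Complex.sub_im,
      Complex.conj_re, Complex.conj_im, Complex.ofReal_re, Complex.ofReal_im, Complex.mul_im,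
      Complex.normSq_apply]
    ring
  rw [e₁, e₂]
  exact key

theorem re_singularPower_sub_mul_conj_nonneg {m : ℝ} (hm0 : 0 < m) (hm1 : m < 1) (z w : ℂ) :
    0 ≤ ((singularPower m z - singularPower m w) * conj (z - w)).re := by
  rcases (add_nonneg (norm_nonneg z) (norm_nonneg w)).eq_or_lt with h | h
  · have hz : z = 0 := norm_le_zero_iff.1 (by linarith [norm_nonneg w])
    have hw : w = 0 := norm_le_zero_iff.1 (by linarith [norm_nonneg z])
    simp [hz, hw]
  · refine nonneg_of_mul_nonneg_right (le_trans ?_ (singularPower_monotone hm0 hm1 z w))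
      (Real.rpow_pos_of_pos h _)
    positivity

/-- Linear growth replaces $|z|^m$, so that $g(u)$ is locally in $L^2$ as soon as $u$ is in $L^2$.
-/
theorem norm_singularPower_le {m : ℝ} (hm0 : 0 < m) (hm1 : m < 1) (z : ℂ) :
    ‖singularPower m z‖ ≤ 1 + ‖z‖ := by
  have hz := norm_nonneg z
  rw [singularPower, norm_mul, Complex.norm_real, Real.norm_of_nonneg (by positivity)]
  rcases le_total 1 ‖z‖ with h | h
  · have := Real.rpow_le_one_of_one_le_of_nonpos h (by linarith : -(1 - m) ≤ 0)
    nlinarith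
  · rcases hz.eq_or_lt with h0 | h0
    · rw [← h0]; simp
    · rw [← Real.rpow_add_one h0.ne']
      have := Real.rpow_le_one hz h (by linarith : 0 ≤ -(1 - m) + 1)
      linarith

@[fun_prop]
theorem measurable_singularPower (m : ℝ) : Measurable (singularPower m) := by
  unfold singularPower
  fun_prop

end Monotonicity

/-! ### $L^2$ pairings -/

section CauchySchwarz

variable {α : Type*} [MeasurableSpace α] {μ : Measure α}

theorem integral_norm_sq_eq_lpNorm_sq {f : α → ℂ} (hf : MemLp f 2 μ) :
    ∫ x, ‖f x‖ ^ 2 ∂μ = lpNorm f 2 μ ^ 2 := by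
  rw [lpNorm_eq_integral_norm_rpow_toReal (by norm_num) (by norm_num) hf.1]
  have h0 : 0 ≤ ∫ x, ‖f x‖ ^ (2 : ℝ≥0∞).toReal ∂μ := integral_nonneg fun x => by positivity
  rw [← Real.rpow_natCast, ← Real.rpow_mul h0]
  simp

theorem norm_integral_mul_le {f g : α → ℂ} (hf : MemLp f 2 μ) (hg : MemLp g 2 μ) :
    ‖∫ x, f x * g x ∂μ‖ ≤ lpNorm f 2 μ * lpNorm g 2 μ := by
  have hpq : (2 : ℝ).HolderConjugate 2 := Real.HolderConjugate.two_two
  have h2 : ENNReal.ofReal 2 = 2 := by simp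
  calc ‖∫ x, f x * g x ∂μ‖ ≤ ∫ x, ‖f x‖ * ‖g x‖ ∂μ := by
        simpa using norm_integral_le_integral_norm (fun x => f x * g x)
    _ ≤ (∫ x, ‖f x‖ ^ (2 : ℝ) ∂μ) ^ (1 / (2 : ℝ)) * (∫ x, ‖g x‖ ^ (2 : ℝ) ∂μ) ^ (1 / (2 : ℝ)) :=
        integral_mul_norm_le_Lp_mul_Lq hpq (by rwa [h2]) (by rwa [h2])
    _ = lpNorm f 2 μ * lpNorm g 2 μ := by
        rw [lpNorm_eq_integral_norm_rpow_toReal (by norm_num) (by norm_num) hf.1,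
          lpNorm_eq_integral_norm_rpow_toReal (by norm_num) (by norm_num) hg.1]
        simp

theorem integrable_mul_of_memLp_two {f g : α → ℂ} (hf : MemLp f 2 μ) (hg : MemLp g 2 μ) :
    Integrable (fun x => f x * g x) μ :=
  hf.integrable_mul hg

theorem memLp_conj {p : ℝ≥0∞} {f : α → ℂ} (hf : MemLp f p μ) :
    MemLp (fun x => conj (f x)) p μ :=
  hf.of_le (Complex.continuous_conj.comp_aestronglyMeasurable hf.1) (by simp)

theorem tendsto_integral_mul_conj {f u : α → ℂ} {v : ℕ → α → ℂ} (hf : MemLp f 2 μ)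
    (hu : MemLp u 2 μ) (hv : ∀ n, MemLp (v n) 2 μ)
    (h : Tendsto (fun n => lpNorm (fun x => u x - v n x) 2 μ) atTop (𝓝 0)) :
    Tendsto (fun n => ∫ x, f x * conj (v n x) ∂μ) atTop (𝓝 (∫ x, f x * conj (u x) ∂μ)) := by
  rw [tendsto_iff_norm_sub_tendsto_zero]
  refine squeeze_zero (fun n => norm_nonneg _) (fun n => ?_)
    (by simpa using h.const_mul (lpNorm f 2 μ))
  have hd : MemLp (fun x => u x - v n x) 2 μ := hu.sub (hv n)
  rw [norm_sub_rev, ← integral_sub (integrable_mul_of_memLp_two hf (memLp_conj hu))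
    (integrable_mul_of_memLp_two hf (memLp_conj (hv n)))]
  calc _ = ‖∫ x, f x * conj (u x - v n x) ∂μ‖ := by
        congr 2
        ext x
        simp [mul_sub]
    _ ≤ lpNorm f 2 μ * lpNorm (fun x => conj (u x - v n x)) 2 μ :=
        norm_integral_mul_le hf (memLp_conj hd)
    _ = _ := by
        congr 1
        exact lpNorm_conj (fun x => u x - v n x) 2 μ

end CauchySchwarz

/-! ### Calculus of test functions -/

section TestFunctions

theorem contDiff_partialDeriv {f : Space N → ℂ} (hf : ContDiff ℝ ∞ f) (j : Fin N) :
    ContDiff ℝ ∞ (partialDeriv j f) :=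
  (hf.fderiv_right (m := ∞) (by simp)).clm_apply contDiff_const

theorem tsupport_partialDeriv_subset (f : Space N → ℂ) (j : Fin N) :
    tsupport (partialDeriv j f) ⊆ tsupport f :=
  tsupport_fderiv_apply_subset ℝ _

theorem hasCompactSupport_partialDeriv {f : Space N → ℂ} (hf : HasCompactSupport f) (j : Fin N) :
    HasCompactSupport (partialDeriv j f) :=
  hf.of_isClosed_subset (isClosed_tsupport _) (tsupport_partialDeriv_subset f j)

theorem partialDeriv_conj (f : Space N → ℂ) (j : Fin N) (x : Space N) :
    partialDeriv j (fun y => conj (f y)) x = conj (partialDeriv j f x) := by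
  have : fderiv ℝ (fun y => conj (f y)) x = Complex.conjCLE.toContinuousLinearMap ∘L fderiv ℝ f x :=
    Complex.conjCLE.comp_fderiv
  simp [partialDeriv, this]

theorem partialDeriv_ofReal_mul {χ : Space N → ℝ} {f : Space N → ℂ} {x : Space N}
    (hχ : DifferentiableAt ℝ χ x) (hf : DifferentiableAt ℝ f x) (j : Fin N) :
    partialDeriv j (fun y => (χ y : ℂ) * f y) x =
      χ x * partialDeriv j f x + fderiv ℝ χ x (EuclideanSpace.single j 1) * f x := by
  have : fderiv ℝ (fun y => χ y • f y) x = χ x • fderiv ℝ f x + (fderiv ℝ χ x).smulRight (f x) :=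
    fderiv_fun_smul hχ hf
  simp only [Complex.real_smul] at this
  simp [partialDeriv, this]

theorem partialDeriv_const_mul {f : Space N → ℂ} {x : Space N} (c : ℂ)
    (hf : DifferentiableAt ℝ f x) (j : Fin N) :
    partialDeriv j (fun y => c * f y) x = c * partialDeriv j f x := by
  simp [partialDeriv, fderiv_const_mul hf]

theorem laplacian_eq_sum_partialDeriv {f : Space N → ℂ} (hf : ContDiff ℝ ∞ f) (x : Space N) :
    Laplacian.laplacian f x = ∑ j, partialDeriv j (partialDeriv j f) x := by
  rw [InnerProductSpace.laplacian_eq_iteratedFDeriv_orthonormalBasis f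
    (EuclideanSpace.basisFun (Fin N) ℝ)]
  refine Finset.sum_congr rfl fun j _ => ?_
  have hd : DifferentiableAt ℝ (fderiv ℝ f) x :=
    (hf.fderiv_right (m := ∞) (by simp)).differentiable (by simp) x
  have : fderiv ℝ (partialDeriv j f) x =
      (fderiv ℝ (fderiv ℝ f) x).flip (EuclideanSpace.single j 1) := by
    have h := fderiv_clm_apply hd (differentiableAt_const (EuclideanSpace.single j (1 : ℝ)))
    simp only [fderiv_fun_const, Pi.zero_apply, ContinuousLinearMap.comp_zero, zero_add] at h
    exact h
  rw [iteratedFDeriv_two_apply, partialDeriv, this]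
  simp

/-- The complex conjugate of a test function. -/
noncomputable def conjTest (φ : 𝓓(Ω, ℂ)) : 𝓓(Ω, ℂ) where
  toFun x := conj (φ x)
  contDiff' := Complex.conjCLE.contDiff.comp φ.contDiff
  hasCompactSupport' := φ.hasCompactSupport.comp_left (map_zero _)
  tsupport_subset' := (tsupport_comp_subset (map_zero (starRingEnd ℂ)) φ).trans φ.tsupport_subset

/-- The partial derivative of a test function. -/
noncomputable def partialTest (j : Fin N) (φ : 𝓓(Ω, ℂ)) : 𝓓(Ω, ℂ) where
  toFun := partialDeriv j φ
  contDiff' := contDiff_partialDeriv φ.contDiff j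
  hasCompactSupport' := hasCompactSupport_partialDeriv φ.hasCompactSupport j
  tsupport_subset' := (tsupport_partialDeriv_subset φ j).trans φ.tsupport_subset

/-- The product of a smooth real function and a test function. -/
noncomputable def mulTest (χ : Space N → ℝ) (hχ : ContDiff ℝ ∞ χ) (φ : 𝓓(Ω, ℂ)) : 𝓓(Ω, ℂ) where
  toFun x := (χ x : ℂ) * φ x
  contDiff' := (Complex.ofRealCLM.contDiff.comp hχ).mul φ.contDiff
  hasCompactSupport' := φ.hasCompactSupport.mul_left
  tsupport_subset' := tsupport_mul_subset_right.trans φ.tsupport_subset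

/-- The product of a complex number and a test function. -/
noncomputable def constMulTest (c : ℂ) (φ : 𝓓(Ω, ℂ)) : 𝓓(Ω, ℂ) where
  toFun x := c * φ x
  contDiff' := contDiff_const.mul φ.contDiff
  hasCompactSupport' := φ.hasCompactSupport.mul_left
  tsupport_subset' := tsupport_mul_subset_right.trans φ.tsupport_subset

@[simp] theorem conjTest_apply (φ : 𝓓(Ω, ℂ)) (x : Space N) : conjTest φ x = conj (φ x) := rfl
@[simp] theorem partialTest_apply (j : Fin N) (φ : 𝓓(Ω, ℂ)) (x : Space N) :
    partialTest j φ x = partialDeriv j φ x := rfl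
@[simp] theorem mulTest_apply (χ : Space N → ℝ) (hχ : ContDiff ℝ ∞ χ) (φ : 𝓓(Ω, ℂ))
    (x : Space N) : mulTest χ hχ φ x = χ x * φ x := rfl
@[simp] theorem constMulTest_apply (c : ℂ) (φ : 𝓓(Ω, ℂ)) (x : Space N) :
    constMulTest c φ x = c * φ x := rfl

theorem memLp_test (φ : 𝓓(Ω, ℂ)) (p : ℝ≥0∞) (s : Set (Space N)) :
    MemLp φ p (volume.restrict s) :=
  (φ.continuous.memLp_of_hasCompactSupport φ.hasCompactSupport).restrict s

theorem differentiableAt_test (φ : 𝓓(Ω, ℂ)) (x : Space N) : DifferentiableAt ℝ φ x :=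
  φ.contDiff.differentiable (by simp) x

end TestFunctions

/-! ### Cutoffs by dilation of one bump -/

section Cutoff

/-- Smooth cutoffs exhausting `ℝ^N` with uniformly bounded gradients. -/
theorem exists_cutoff (N : ℕ) : ∃ χ : ℕ → Space N → ℝ,
    (∀ n, ContDiff ℝ ∞ (χ n)) ∧ (∀ n, HasCompactSupport (χ n)) ∧
    (∀ n x, 0 ≤ χ n x ∧ χ n x ≤ 1) ∧
    (∃ C, ∀ n x j, ‖fderiv ℝ (χ n) x (EuclideanSpace.single j 1)‖ ≤ C) ∧
    ∀ x, ∀ᶠ n in atTop, χ n x = 1 ∧ fderiv ℝ (χ n) x = 0 := by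
  let η : ContDiffBump (0 : Space N) := ⟨1, 2, one_pos, one_lt_two⟩
  have hη : ContDiff ℝ ∞ η := η.contDiff
  have hη1 : ∀ y : Space N, ‖y‖ < 1 → η =ᶠ[𝓝 y] 1 := fun y hy =>
    η.eventuallyEq_one_of_mem_ball (by simpa [η] using hy)
  have hpos : ∀ n : ℕ, (0 : ℝ) < ((n : ℝ) + 1)⁻¹ := fun n => by positivity
  have hfd : ∀ (n : ℕ) (x : Space N), fderiv ℝ (fun x => η (((n : ℝ) + 1)⁻¹ • x)) x =
      ((n : ℝ) + 1)⁻¹ • fderiv ℝ η (((n : ℝ) + 1)⁻¹ • x) := fun n x =>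
    fderiv_comp_smul (f := η) (((n : ℝ) + 1)⁻¹)
  refine ⟨fun n x => η (((n : ℝ) + 1)⁻¹ • x), fun n => hη.comp (contDiff_const_smul _),
    fun n => ?_, fun n x => ⟨η.nonneg, η.le_one⟩, ?_, fun x => ?_⟩
  · exact η.hasCompactSupport.comp_smul (hpos n).ne'
  · obtain ⟨C, hC⟩ := (hη.continuous_fderiv (by simp)).bounded_above_of_compact_support
      (η.hasCompactSupport.fderiv ℝ)
    refine ⟨C, fun n x j => ?_⟩
    rw [hfd]
    -- The dilation factor only shrinks the gradient, so the bound for the bump itself works for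
    -- every $n$.
    have h1 : ((n : ℝ) + 1)⁻¹ ≤ 1 := inv_le_one_of_one_le₀ (by linarith [n.cast_nonneg (α := ℝ)])
    calc _ ≤ ‖((n : ℝ) + 1)⁻¹ • fderiv ℝ η (((n : ℝ) + 1)⁻¹ • x)‖ *
          ‖(EuclideanSpace.single j 1 : Space N)‖ := ContinuousLinearMap.le_opNorm _ _
      _ = ((n : ℝ) + 1)⁻¹ * ‖fderiv ℝ η (((n : ℝ) + 1)⁻¹ • x)‖ := by
          rw [norm_smul, Real.norm_of_nonneg (hpos n).le]; simp
      _ ≤ 1 * C := mul_le_mul h1 (hC _) (norm_nonneg _) zero_le_one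
      _ = C := one_mul C
  · have hlim : Tendsto (fun n : ℕ => ‖((n : ℝ) + 1)⁻¹ • x‖) atTop (𝓝 0) := by
      have : Tendsto (fun n : ℕ => ((n : ℝ) + 1)⁻¹) atTop (𝓝 0) := by
        simpa using tendsto_one_div_add_atTop_nhds_zero_nat (𝕜 := ℝ)
      simpa using (this.smul_const x).norm
    filter_upwards [hlim.eventually_lt_const one_pos] with n hn
    refine ⟨(hη1 _ hn).eq_of_nhds, ?_⟩
    rw [hfd, (hη1 _ hn).fderiv_eq]
    simp

end Cutoff

/-! ### Weak formulation and enlarged class of test functions -/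

section WeakForm

/-- The product is dominated by $|\psi|+|u\psi|$. The exponents in use are $(p,q)=(1,2)$ with test
functions and $(2,\infty)$ with cutoffs. -/
theorem memLp_singularPower_mul {m : ℝ} (hm0 : 0 < m) (hm1 : m < 1) {u ψ : Space N → ℂ}
    (hu : MemLpOn Ω 2 u) (hψ : Continuous ψ) (hψc : HasCompactSupport ψ) {p q : ℝ≥0∞}
    [ENNReal.HolderTriple 2 q p] :
    MemLp (fun x => singularPower m (u x) * ψ x) p (volume.restrict (Ω : Set (Space N))) := by
  have hψL : ∀ r, MemLp ψ r (volume.restrict (Ω : Set (Space N))) := fun r =>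
    (hψ.memLp_of_hasCompactSupport hψc).restrict _
  have huψ : MemLp (fun x => u x * ψ x) p (volume.restrict (Ω : Set (Space N))) :=
    (hψL q).mul hu
  refine ((hψL p).norm.add huψ.norm).mono
    (((measurable_singularPower m).comp_aemeasurable hu.1.aemeasurable).aestronglyMeasurable.mul
      (hψL p).1) (ae_of_all _ fun x => ?_)
  have := norm_singularPower_le hm0 hm1 (u x)
  simp only [Pi.add_apply, norm_mul]
  rw [Real.norm_of_nonneg (by positivity)]
  nlinarith [norm_nonneg (ψ x)]

theorem memLp_zeroOrder_mul {m : ℝ} (hm0 : 0 < m) (hm1 : m < 1) (a b : ℂ) {u ψ : Space N → ℂ}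
    (hu : MemLpOn Ω 2 u) (hψ : Continuous ψ) (hψc : HasCompactSupport ψ) {p q : ℝ≥0∞}
    [ENNReal.HolderTriple 2 q p] :
    MemLp (fun x => (a * singularPower m (u x) + b * u x) * ψ x) p
      (volume.restrict (Ω : Set (Space N))) := by
  have hψL : MemLp ψ q (volume.restrict (Ω : Set (Space N))) :=
    (hψ.memLp_of_hasCompactSupport hψc).restrict _
  have huψ : MemLp (fun x => u x * ψ x) p (volume.restrict (Ω : Set (Space N))) := hψL.mul hu
  have hpow := memLp_singularPower_mul hm0 hm1 hu hψ hψc (p := p) (q := q)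
  convert (hpow.const_mul a).add (huψ.const_mul b) using 1
  ext x
  simp only [Pi.add_apply]
  ring

theorem integrable_mul_test {F : Space N → ℂ} (hF : MemLpLocOn Ω 1 F) (φ : 𝓓(Ω, ℂ)) :
    Integrable (fun x => F x * φ x) (volume.restrict (Ω : Set (Space N))) := by
  have hK : IsCompact (tsupport φ) := φ.hasCompactSupport
  have hFK : IntegrableOn F (tsupport φ) volume :=
    memLp_one_iff_integrable.1 (hF _ hK φ.tsupport_subset)
  obtain ⟨C, hC⟩ := φ.continuous.bounded_above_of_compact_support φ.hasCompactSupport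
  have hmul : IntegrableOn (fun x => F x * φ x) (tsupport φ) volume :=
    Integrable.mul_bdd hFK φ.continuous.aestronglyMeasurable (ae_of_all _ hC)
  refine ((integrableOn_iff_integrable_of_support_subset ?_).1 hmul).restrict
  exact (Function.support_mul_subset_right _ _).trans (subset_tsupport _)

/-- Each $\overline{\partial_j\varphi}$ is again a test function, so the definition of the weak
derivative applies to it. -/
theorem integral_mul_conj_laplacian {u : Space N → ℂ} {G : Fin N → Space N → ℂ}
    (hu : MemLpOn Ω 2 u) (hG : ∀ j, HasWeakPartial Ω j u (G j)) (φ : 𝓓(Ω, ℂ)) :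
    ∫ x in (Ω : Set (Space N)), u x * conj (Laplacian.laplacian (φ : Space N → ℂ) x) =
      -∑ j, ∫ x in (Ω : Set (Space N)), G j x * conj (partialDeriv j φ x) := by
  have h : ∀ x, u x * conj (Laplacian.laplacian (φ : Space N → ℂ) x) =
      ∑ j, u x * partialDeriv j (conjTest (partialTest j φ)) x := by
    intro x
    rw [laplacian_eq_sum_partialDeriv φ.contDiff, map_sum, Finset.mul_sum]
    refine Finset.sum_congr rfl fun j _ => ?_
    rw [← partialDeriv_conj]
    rfl
  simp_rw [h]
  have hint : ∀ j, Integrable (fun x => u x * partialDeriv j (conjTest (partialTest j φ)) x)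
      (volume.restrict (Ω : Set (Space N))) := fun j => integrable_mul_of_memLp_two hu
    (memLp_test (partialTest j (conjTest (partialTest j φ))) 2 _)
  rw [integral_finsetSum _ fun j _ => hint j, ← Finset.sum_neg_distrib]
  exact Finset.sum_congr rfl fun j _ => hG j _

/-- The weak formulation, tested against gradients and as an identity of complex numbers. -/
theorem IsLocalWeakSolution.weak_form {m : ℝ} (hm0 : 0 < m) (hm1 : m < 1) {a b : ℂ}
    {F u : Space N → ℂ} {G : Fin N → Space N → ℂ} (h : IsLocalWeakSolution Ω m a b F u)
    (hu : MemLpOn Ω 2 u) (hG : ∀ j, HasWeakPartial Ω j u (G j)) (φ : 𝓓(Ω, ℂ)) :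
    Complex.I * (∑ j, ∫ x in (Ω : Set (Space N)), G j x * conj (partialDeriv j φ x)) +
      ∫ x in (Ω : Set (Space N)), (a * singularPower m (u x) + b * u x) * conj (φ x) =
      ∫ x in (Ω : Set (Space N)), F x * conj (φ x) := by
  have hre : ∀ ψ : 𝓓(Ω, ℂ),
      (Complex.I * (∑ j, ∫ x in (Ω : Set (Space N)), G j x * conj (partialDeriv j ψ x)) +
        ∫ x in (Ω : Set (Space N)), (a * singularPower m (u x) + b * u x) * conj (ψ x)).re =
      (∫ x in (Ω : Set (Space N)), F x * conj (ψ x)).re := by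
    intro ψ
    rw [← h.2 ψ]
    congr 1
    have hlap : Integrable (fun x => u x * conj (Laplacian.laplacian (ψ : Space N → ℂ) x))
        (volume.restrict (Ω : Set (Space N))) := by
      refine integrable_mul_of_memLp_two hu (memLp_conj ?_)
      rw [funext (laplacian_eq_sum_partialDeriv ψ.contDiff)]
      exact memLp_finsetSum _ fun j _ => memLp_test (partialTest j (partialTest j ψ)) 2 _
    have hrest : Integrable (fun x => (a * singularPower m (u x) + b * u x) * conj (ψ x))
        (volume.restrict (Ω : Set (Space N))) :=
      memLp_one_iff_integrable.1 (memLp_zeroOrder_mul hm0 hm1 a b hu (conjTest ψ).continuous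
        (conjTest ψ).hasCompactSupport (q := 2))
    have hlap' : Integrable
        (fun x => -Complex.I * u x * conj (Laplacian.laplacian (ψ : Space N → ℂ) x))
        (volume.restrict (Ω : Set (Space N))) := by
      simpa only [mul_assoc] using hlap.const_mul (-Complex.I)
    rw [integral_add hlap' hrest]
    simp only [mul_assoc (-Complex.I)]
    rw [integral_const_mul, integral_mul_conj_laplacian hu hG]
    ring
  refine Complex.ext (hre φ) ?_
  -- The real-part identity at $i\varphi$ is the imaginary-part identity at $\varphi$, since
  -- $\operatorname{Re}(\bar i z)=\operatorname{Im}z$.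
  have hI := hre (constMulTest Complex.I φ)
  have hpd : ∀ j x, partialDeriv j (constMulTest Complex.I φ) x =
      Complex.I * partialDeriv j φ x := fun j x =>
    partialDeriv_const_mul Complex.I (differentiableAt_test φ x) j
  simp only [hpd, constMulTest_apply, map_mul, mul_left_comm _ (conj Complex.I),
    integral_const_mul, ← Finset.mul_sum] at hI
  rw [← mul_add] at hI
  simpa [Complex.mul_re] using hI

/-- A weak identity extends from test functions to `χ u`, for a cutoff `χ` and `u ∈ H^1_0`. -/
theorem weak_form_cutoff_mul {u K : Space N → ℂ} {G : Fin N → Space N → ℂ} {χ : Space N → ℝ}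
    (hu : MemLpOn Ω 2 u) (hG : ∀ j, MemLpOn Ω 2 (G j)) (hχ : ContDiff ℝ ∞ χ)
    (hχc : HasCompactSupport χ) (hK : MemLpOn Ω 2 (fun x => K x * χ x))
    (hweak : ∀ φ : 𝓓(Ω, ℂ),
      Complex.I * (∑ j, ∫ x in (Ω : Set (Space N)), G j x * conj (partialDeriv j φ x)) +
        ∫ x in (Ω : Set (Space N)), K x * conj (φ x) = 0)
    (happrox : ∀ ε : ℝ, 0 < ε → ∃ φ : 𝓓(Ω, ℂ), normLpOn Ω 2 (fun x => u x - φ x) ≤ ε ∧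
      ∀ j, normLpOn Ω 2 (fun x => G j x - partialDeriv j φ x) ≤ ε) :
    Complex.I * ∑ j, ((∫ x in (Ω : Set (Space N)), G j x * χ x * conj (G j x)) +
        ∫ x in (Ω : Set (Space N)),
          G j x * fderiv ℝ χ x (EuclideanSpace.single j 1) * conj (u x)) +
      ∫ x in (Ω : Set (Space N)), K x * χ x * conj (u x) = 0 := by
  have hbdd : ∀ {f : Space N → ℂ} {η : Space N → ℝ}, MemLpOn Ω 2 f → Continuous η →
      HasCompactSupport η → MemLpOn Ω 2 (fun x => f x * η x) := by
    intro f η hf hη hηc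
    have hη' : MemLp (fun x => (η x : ℂ)) ∞ (volume.restrict (Ω : Set (Space N))) :=
      ((Complex.continuous_ofReal.comp hη).memLp_of_hasCompactSupport
        (hηc.comp_left Complex.ofReal_zero)).restrict _
    exact hη'.mul hf
  have hdχ : ∀ j : Fin N, Continuous fun x => fderiv ℝ χ x (EuclideanSpace.single j 1) := fun j =>
    (hχ.continuous_fderiv (by simp)).clm_apply continuous_const
  have hGχ := fun j => hbdd (hG j) hχ.continuous hχc
  have hGdχ := fun j => hbdd (hG j) (hdχ j) (hχc.fderiv_apply ℝ _)
  choose φ hφ hφG using fun n : ℕ => happrox (1 / ((n : ℝ) + 1)) (by positivity)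
  have h0 := tendsto_one_div_add_atTop_nhds_zero_nat (𝕜 := ℝ)
  have hlu : Tendsto (fun n => lpNorm (fun x => u x - φ n x) 2
      (volume.restrict (Ω : Set (Space N)))) atTop (𝓝 0) :=
    squeeze_zero (fun n => lpNorm_nonneg) hφ h0
  have hlG : ∀ j, Tendsto (fun n => lpNorm (fun x => G j x - partialDeriv j (φ n) x) 2
      (volume.restrict (Ω : Set (Space N)))) atTop (𝓝 0) := fun j =>
    squeeze_zero (fun n => lpNorm_nonneg) (fun n => hφG n j) h0
  have hmu : ∀ n, MemLpOn Ω 2 (φ n) := fun n => memLp_test _ 2 _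
  have hmG : ∀ j n, MemLpOn Ω 2 (partialDeriv j (φ n)) := fun j n =>
    memLp_test (partialTest j (φ n)) 2 _
  have hlim := ((tendsto_finsetSum Finset.univ fun j _ =>
    (tendsto_integral_mul_conj (hGχ j) (hG j) (hmG j) (hlG j)).add
      (tendsto_integral_mul_conj (hGdχ j) hu hmu hlu)).const_mul Complex.I).add
    (tendsto_integral_mul_conj hK hu hmu hlu)
  -- Each $\chi\varphi_n$ is a test function, so the converging sequence is constantly $0$.
  refine tendsto_nhds_unique hlim (tendsto_const_nhds.congr fun n => ?_)
  rw [← hweak (mulTest χ hχ (φ n))]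
  congr 2
  · refine Finset.sum_congr rfl fun j _ => ?_
    rw [← integral_add (integrable_mul_of_memLp_two (hGχ j) (memLp_conj (hmG j n)))
      (integrable_mul_of_memLp_two (hGdχ j) (memLp_conj (hmu n)))]
    congr 1
    ext x
    have : partialDeriv j (mulTest χ hχ (φ n)) x = _ :=
      partialDeriv_ofReal_mul (hχ.differentiable (by simp) x) (differentiableAt_test (φ n) x) j
    rw [this]
    simp only [map_add, map_mul, Complex.conj_ofReal]
    ring
  · ext x
    simp [mul_assoc]

end WeakForm

/-! ### Energy estimate -/

section Energy

/-- Dominated convergence, used with $k=1$ for the cutoffs and $k=0$ for their derivatives. -/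
theorem tendsto_integral_smul_of_eventually_eq {α E : Type*} [MeasurableSpace α]
    [NormedAddCommGroup E] [NormedSpace ℝ E] {μ : Measure α} {f : α → E} {η : ℕ → α → ℝ}
    {C k : ℝ} (hf : Integrable f μ) (hη : ∀ n, AEStronglyMeasurable (η n) μ)
    (hC : ∀ n x, ‖η n x‖ ≤ C) (hk : ∀ x, ∀ᶠ n in atTop, η n x = k) :
    Tendsto (fun n => ∫ x, η n x • f x ∂μ) atTop (𝓝 (k • ∫ x, f x ∂μ)) := by
  rw [← integral_smul]
  refine tendsto_integral_of_dominated_convergence (fun x => C * ‖f x‖)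
    (fun n => (hη n).smul hf.1) (hf.norm.const_mul C) (fun n => ae_of_all _ fun x => ?_)
    (ae_of_all _ fun x => ?_)
  · rw [norm_smul]
    exact mul_le_mul_of_nonneg_right (hC n x) (norm_nonneg _)
  · exact tendsto_const_nhds.congr' ((hk x).mono fun n hn => by simp only [hn])

/-- The energy estimate: if `-iΔu + K = F` with `u ∈ H^1_0`, `Re (c i) ≥ 0` and
`Re (c K ū) ≥ δ |u|²`, then `δ ‖u‖ ≤ |c| ‖F‖` in `L²`. -/
theorem energy_estimate {u K F : Space N → ℂ} {G : Fin N → Space N → ℂ} {c : ℂ} {δ : ℝ}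
    (hu : MemLpOn Ω 2 u) (hG : ∀ j, MemLpOn Ω 2 (G j)) (hF : MemLpOn Ω 2 F)
    (hK : ∀ χ : Space N → ℝ, Continuous χ → HasCompactSupport χ →
      MemLpOn Ω 2 (fun x => K x * χ x))
    (hweak : ∀ φ : 𝓓(Ω, ℂ),
      Complex.I * (∑ j, ∫ x in (Ω : Set (Space N)), G j x * conj (partialDeriv j φ x)) +
        ∫ x in (Ω : Set (Space N)), (K x - F x) * conj (φ x) = 0)
    (happrox : ∀ ε : ℝ, 0 < ε → ∃ φ : 𝓓(Ω, ℂ), normLpOn Ω 2 (fun x => u x - φ x) ≤ ε ∧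
      ∀ j, normLpOn Ω 2 (fun x => G j x - partialDeriv j φ x) ≤ ε)
    (hc : 0 ≤ (c * Complex.I).re)
    (hδ : ∀ᵐ x ∂volume.restrict (Ω : Set (Space N)), δ * ‖u x‖ ^ 2 ≤ (c * (K x * conj (u x))).re) :
    δ * normLpOn Ω 2 u ≤ ‖c‖ * normLpOn Ω 2 F := by
  set μ := volume.restrict (Ω : Set (Space N)) with hμ
  obtain ⟨χ, hχ, hχc, hχ01, ⟨C, hC⟩, hχlim⟩ := exists_cutoff N
  have hdχ : ∀ n (j : Fin N), Continuous fun x => fderiv ℝ (χ n) x (EuclideanSpace.single j 1) :=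
    fun n j => ((hχ n).continuous_fderiv (by simp)).clm_apply continuous_const
  have hχ1 : ∀ n x, ‖χ n x‖ ≤ 1 := fun n x => by
    rw [Real.norm_of_nonneg (hχ01 n x).1]; exact (hχ01 n x).2
  have hsq : Integrable (fun x => ‖u x‖ ^ 2) μ := hu.integrable_norm_pow (by norm_num)
  have hFu : Integrable (fun x => F x * conj (u x)) μ :=
    integrable_mul_of_memLp_two hF (memLp_conj hu)
  have hGu : ∀ j, Integrable (fun x => G j x * conj (u x)) μ := fun j =>
    integrable_mul_of_memLp_two (hG j) (memLp_conj hu)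
  have hbdd : ∀ n {f : Space N → ℂ}, MemLpOn Ω 2 f → MemLpOn Ω 2 (fun x => f x * χ n x) := by
    intro n f hf
    have hη' : MemLp (fun x => (χ n x : ℂ)) ∞ μ :=
      ((Complex.continuous_ofReal.comp (hχ n).continuous).memLp_of_hasCompactSupport
        ((hχc n).comp_left Complex.ofReal_zero)).restrict _
    exact hη'.mul hf
  -- Real part of $c$ times the identity tested with $\chi_n u$, after discarding the nonnegative
  -- gradient term; the last sum comes from $\nabla\chi_n$.
  have hstep : ∀ n, δ * ∫ x, χ n x • ‖u x‖ ^ 2 ∂μ ≤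
      (c * ∫ x, χ n x • (F x * conj (u x)) ∂μ).re -
        (c * Complex.I * ∑ j, ∫ x, (fderiv ℝ (χ n) x (EuclideanSpace.single j 1)) •
          (G j x * conj (u x)) ∂μ).re := by
    intro n
    have hKn := hK (χ n) (hχ n).continuous (hχc n)
    have hKF : MemLpOn Ω 2 (fun x => (K x - F x) * χ n x) := by
      simp only [sub_mul]
      exact hKn.sub (hbdd n hF)
    have hid := weak_form_cutoff_mul (G := G) hu hG (hχ n) (hχc n) hKF hweak happrox
    have hKint : Integrable (fun x => K x * χ n x * conj (u x)) μ :=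
      integrable_mul_of_memLp_two hKn (memLp_conj hu)
    have hsplit : ∫ x, (K x - F x) * χ n x * conj (u x) ∂μ =
        (∫ x, K x * χ n x * conj (u x) ∂μ) - ∫ x, χ n x • (F x * conj (u x)) ∂μ := by
      have hFint : Integrable (fun x => χ n x • (F x * conj (u x))) μ := by
        refine (integrable_mul_of_memLp_two (hbdd n hF) (memLp_conj hu)).congr
          (ae_of_all _ fun x => ?_)
        simp only [Complex.real_smul]
        ring
      rw [← integral_sub hKint hFint]
      congr 1
      ext x
      simp only [Complex.real_smul]
      ring
    have hGG : ∀ j, ∫ x, G j x * χ n x * conj (G j x) ∂μ =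
        ((∫ x, χ n x * ‖G j x‖ ^ 2 ∂μ : ℝ) : ℂ) := by
      intro j
      rw [← integral_complex_ofReal]
      congr 1
      ext x
      rw [mul_right_comm, Complex.mul_conj, Complex.normSq_eq_norm_sq]
      push_cast
      ring
    have hGdχ : ∀ j, ∫ x, G j x * fderiv ℝ (χ n) x (EuclideanSpace.single j 1) * conj (u x) ∂μ =
        ∫ x, (fderiv ℝ (χ n) x (EuclideanSpace.single j 1)) • (G j x * conj (u x)) ∂μ := by
      intro j
      congr 1
      ext x
      simp only [Complex.real_smul]
      ring
    -- The lower bound enters while $\chi_n$ is still present, because $K\bar u$ is not known to be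
    -- integrable on $\Omega$.
    have hlow : δ * ∫ x, χ n x • ‖u x‖ ^ 2 ∂μ ≤ (c * ∫ x, K x * χ n x * conj (u x) ∂μ).re := by
      have hcomm : (c * ∫ x, K x * χ n x * conj (u x) ∂μ).re =
          ∫ x, (c * (K x * χ n x * conj (u x))).re ∂μ := by
        rw [← integral_const_mul]
        exact (integral_re (hKint.const_mul c)).symm
      rw [hcomm, ← integral_const_mul]
      refine integral_mono_ae ?_ (hKint.const_mul c).re ?_
      · exact (hsq.bdd_smul 1 (hχ n).continuous.aestronglyMeasurable
          (ae_of_all _ (hχ1 n))).const_mul δ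
      · filter_upwards [hδ] with x hx
        have : c * (K x * χ n x * conj (u x)) = (χ n x : ℂ) * (c * (K x * conj (u x))) := by ring
        rw [this, Complex.re_ofReal_mul, smul_eq_mul, mul_left_comm]
        exact mul_le_mul_of_nonneg_left hx (hχ01 n x).1
    have hgrad : 0 ≤ (c * Complex.I).re * ∑ j, ∫ x, χ n x * ‖G j x‖ ^ 2 ∂μ :=
      mul_nonneg hc (Finset.sum_nonneg fun j _ => integral_nonneg fun x =>
        mul_nonneg (hχ01 n x).1 (sq_nonneg _))
    rw [← hμ, hsplit] at hid
    simp only [hGG, hGdχ, Finset.sum_add_distrib, ← Complex.ofReal_sum] at hid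
    have hre := congrArg (fun z => (c * z).re) hid
    simp only [mul_add, mul_sub, mul_zero, Complex.zero_re, Complex.add_re, Complex.sub_re,
      ← mul_assoc c Complex.I, Complex.re_mul_ofReal] at hre
    linarith
  have hlim₁ : Tendsto (fun n => δ * ∫ x, χ n x • ‖u x‖ ^ 2 ∂μ) atTop
      (𝓝 (δ * ((1 : ℝ) • ∫ x, ‖u x‖ ^ 2 ∂μ))) :=
    (tendsto_integral_smul_of_eventually_eq hsq (fun n => (hχ n).continuous.aestronglyMeasurable)
      hχ1 fun x => (hχlim x).mono fun n h => h.1).const_mul δ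
  have hlim₂ : Tendsto (fun n => c * ∫ x, χ n x • (F x * conj (u x)) ∂μ) atTop
      (𝓝 (c * ((1 : ℝ) • ∫ x, F x * conj (u x) ∂μ))) :=
    (tendsto_integral_smul_of_eventually_eq hFu (fun n => (hχ n).continuous.aestronglyMeasurable)
      hχ1 fun x => (hχlim x).mono fun n h => h.1).const_mul c
  have hlim₃ : Tendsto (fun n => c * Complex.I * ∑ j, ∫ x,
      (fderiv ℝ (χ n) x (EuclideanSpace.single j 1)) • (G j x * conj (u x)) ∂μ) atTop
      (𝓝 (c * Complex.I * ∑ j, (0 : ℝ) • ∫ x, G j x * conj (u x) ∂μ)) :=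
    (tendsto_finsetSum _ fun j _ => tendsto_integral_smul_of_eventually_eq (hGu j)
      (fun n => (hdχ n j).aestronglyMeasurable) (fun n x => hC n x j)
      fun x => (hχlim x).mono fun n h => by simp [h.2]).const_mul _
  have hfin := le_of_tendsto_of_tendsto' hlim₁
    (((Complex.continuous_re.tendsto _).comp hlim₂).sub
      ((Complex.continuous_re.tendsto _).comp hlim₃)) hstep
  simp only [one_smul, zero_smul, Finset.sum_const_zero, mul_zero, Complex.zero_re,
    sub_zero] at hfin
  rw [integral_norm_sq_eq_lpNorm_sq hu] at hfin
  have hCS : (c * ∫ x, F x * conj (u x) ∂μ).re ≤ ‖c‖ * (lpNorm F 2 μ * lpNorm u 2 μ) := by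
    refine (Complex.re_le_norm _).trans ?_
    rw [norm_mul, ← lpNorm_conj u 2 μ]
    exact mul_le_mul_of_nonneg_left (norm_integral_mul_le hF (memLp_conj hu)) (norm_nonneg c)
  change δ * lpNorm u 2 μ ≤ ‖c‖ * lpNorm F 2 μ
  rcases (lpNorm_nonneg (f := u) (p := 2) (μ := μ)).eq_or_lt with h0 | h0
  · rw [← h0, mul_zero]
    exact mul_nonneg (norm_nonneg c) lpNorm_nonneg
  · refine le_of_mul_le_mul_right ?_ h0
    linarith

/-- The energy estimate for the difference of two global weak solutions. -/
theorem IsGlobalWeakSolution.difference_estimate {m : ℝ} (hm0 : 0 < m) (hm1 : m < 1) {a b c : ℂ}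
    {δ : ℝ} {F₁ F₂ u₁ u₂ : Space N → ℂ} (h₁ : IsGlobalWeakSolution Ω m a b F₁ u₁)
    (h₂ : IsGlobalWeakSolution Ω m a b F₂ u₂) (hF₁ : MemLpLocOn Ω 1 F₁)
    (hF₂ : MemLpLocOn Ω 1 F₂) (hF : MemLpOn Ω 2 (fun x => F₁ x - F₂ x))
    (hc : 0 ≤ (c * Complex.I).re)
    (hδ : ∀ᵐ x ∂volume.restrict (Ω : Set (Space N)), δ * ‖u₁ x - u₂ x‖ ^ 2 ≤
      (c * ((a * (singularPower m (u₁ x) - singularPower m (u₂ x)) + b * (u₁ x - u₂ x)) *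
        conj (u₁ x - u₂ x))).re) :
    δ * normLpOn Ω 2 (fun x => u₁ x - u₂ x) ≤ ‖c‖ * normLpOn Ω 2 (fun x => F₁ x - F₂ x) := by
  obtain ⟨hs₁, ⟨hu₁, G₁, hG₁, ha₁⟩, -⟩ := h₁
  obtain ⟨hs₂, ⟨hu₂, G₂, hG₂, ha₂⟩, -⟩ := h₂
  have hzero : ∀ x, a * (singularPower m (u₁ x) - singularPower m (u₂ x)) + b * (u₁ x - u₂ x) =
      (a * singularPower m (u₁ x) + b * u₁ x) - (a * singularPower m (u₂ x) + b * u₂ x) :=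
    fun x => by ring
  refine energy_estimate (G := fun j x => G₁ j x - G₂ j x)
    (K := fun x => a * (singularPower m (u₁ x) - singularPower m (u₂ x)) + b * (u₁ x - u₂ x))
    (hu₁.sub hu₂) (fun j => (hG₁ j).1.sub (hG₂ j).1) hF ?_ ?_ ?_ hc hδ
  · intro χ hχ hχc
    simp only [hzero, sub_mul]
    have hχ' := Complex.continuous_ofReal.comp hχ
    have hχc' : HasCompactSupport fun x => (χ x : ℂ) := hχc.comp_left Complex.ofReal_zero
    exact (memLp_zeroOrder_mul hm0 hm1 a b hu₁ hχ' hχc' (q := ∞)).sub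
      (memLp_zeroOrder_mul hm0 hm1 a b hu₂ hχ' hχc' (q := ∞))
  · intro φ
    -- Each $F_i$ is only locally integrable, so the identities are subtracted at the level of test
    -- functions; only $F_1-F_2$ is in $L^2$.
    have e₁ := hs₁.weak_form hm0 hm1 hu₁ (fun j => (hG₁ j).2) φ
    have e₂ := hs₂.weak_form hm0 hm1 hu₂ (fun j => (hG₂ j).2) φ
    have hgrad : ∀ j, ∫ x in (Ω : Set (Space N)),
        (G₁ j x - G₂ j x) * conj (partialDeriv j φ x) =
        (∫ x in (Ω : Set (Space N)), G₁ j x * conj (partialDeriv j φ x)) -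
          ∫ x in (Ω : Set (Space N)), G₂ j x * conj (partialDeriv j φ x) := by
      intro j
      have hφj := memLp_conj (memLp_test (partialTest j φ) 2 (Ω : Set (Space N)))
      simp only [sub_mul]
      exact integral_sub (integrable_mul_of_memLp_two (hG₁ j).1 hφj)
        (integrable_mul_of_memLp_two (hG₂ j).1 hφj)
    have hz : ∀ {u : Space N → ℂ}, MemLpOn Ω 2 u →
        Integrable (fun x => (a * singularPower m (u x) + b * u x) * conj (φ x))
          (volume.restrict (Ω : Set (Space N))) := fun hu =>
      memLp_one_iff_integrable.1 (memLp_zeroOrder_mul hm0 hm1 a b hu (conjTest φ).continuous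
        (conjTest φ).hasCompactSupport (q := 2))
    have hf₁ := integrable_mul_test hF₁ (conjTest φ)
    have hf₂ := integrable_mul_test hF₂ (conjTest φ)
    simp only [conjTest_apply] at hf₁ hf₂
    have hz₁₂ : Integrable (fun x => (a * singularPower m (u₁ x) + b * u₁ x) * conj (φ x) -
        (a * singularPower m (u₂ x) + b * u₂ x) * conj (φ x))
        (volume.restrict (Ω : Set (Space N))) := (hz hu₁).sub (hz hu₂)
    have hf₁₂ : Integrable (fun x => F₁ x * conj (φ x) - F₂ x * conj (φ x))
        (volume.restrict (Ω : Set (Space N))) := hf₁.sub hf₂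
    simp only [hgrad, Finset.sum_sub_distrib]
    simp only [hzero, sub_mul]
    rw [integral_sub hz₁₂ hf₁₂, integral_sub (hz hu₁) (hz hu₂), integral_sub hf₁ hf₂]
    linear_combination e₁ - e₂
  · intro ε hε
    obtain ⟨φ₁, hφ₁, hφG₁⟩ := ha₁ (ε / 2) (by positivity)
    obtain ⟨φ₂, hφ₂, hφG₂⟩ := ha₂ (ε / 2) (by positivity)
    have htri : ∀ {f₁ f₂ g₁ g₂ : Space N → ℂ}, MemLpOn Ω 2 f₁ → MemLpOn Ω 2 g₁ →
        normLpOn Ω 2 (fun x => f₁ x - g₁ x) ≤ ε / 2 →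
        normLpOn Ω 2 (fun x => f₂ x - g₂ x) ≤ ε / 2 →
        normLpOn Ω 2 (fun x => f₁ x - f₂ x - (g₁ x - g₂ x)) ≤ ε := by
      intro f₁ f₂ g₁ g₂ hf hg hfg₁ hfg₂
      have := lpNorm_sub_le (g := fun x => f₂ x - g₂ x) (hf.sub hg) (by norm_num)
      have he : (fun x => f₁ x - f₂ x - (g₁ x - g₂ x)) =
          (f₁ - g₁) - fun x => f₂ x - g₂ x := by
        ext x
        simp only [Pi.sub_apply]
        ring
      rw [normLpOn, he]
      exact this.trans (by rw [← add_halves ε]; exact add_le_add hfg₁ hfg₂)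
    refine ⟨φ₁ - φ₂, htri hu₁ (memLp_test φ₁ 2 _) hφ₁ hφ₂, fun j => ?_⟩
    have hpd : ∀ x, partialDeriv j (φ₁ - φ₂ : 𝓓(Ω, ℂ)) x =
        partialDeriv j φ₁ x - partialDeriv j φ₂ x := by
      intro x
      have : fderiv ℝ (fun y => φ₁ y - φ₂ y) x = fderiv ℝ φ₁ x - fderiv ℝ φ₂ x :=
        fderiv_fun_sub (differentiableAt_test φ₁ x) (differentiableAt_test φ₂ x)
      exact congrArg (fun L => L (EuclideanSpace.single j 1)) this
    simp only [hpd]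
    exact htri (hG₁ j).1 (memLp_test (partialTest j φ₁) 2 _) (hφG₁ j) (hφG₂ j)

end Energy

/-! ### The three choices of multiplier -/

section Uniqueness

/-- Multiplying by $\bar a$ makes the coefficient of the nonlinearity real and nonnegative. -/
theorem re_conj_mul_zeroOrder (a b s w : ℂ) :
    (conj a * ((a * s + b * w) * conj w)).re =
      ‖a‖ ^ 2 * (s * conj w).re + (a * conj b).re * ‖w‖ ^ 2 := by
  simp only [Complex.sq_norm, Complex.normSq_apply, Complex.mul_re, Complex.mul_im, Complex.add_re,
    Complex.add_im, Complex.conj_re, Complex.conj_im]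
  ring

variable {m : ℝ} {a b : ℂ} {F₁ F₂ u₁ u₂ : Space N → ℂ}

theorem norm_sub_le_of_re_mul_conj_pos (hm0 : 0 < m) (hm1 : m < 1)
    (h₁ : IsGlobalWeakSolution Ω m a b F₁ u₁) (h₂ : IsGlobalWeakSolution Ω m a b F₂ u₂)
    (hF₁ : MemLpLocOn Ω 1 F₁) (hF₂ : MemLpLocOn Ω 1 F₂)
    (hF : MemLpOn Ω 2 (fun x => F₁ x - F₂ x)) (ha : 0 ≤ a.im) (hab : 0 < (a * conj b).re) :
    normLpOn Ω 2 (fun x => u₁ x - u₂ x) ≤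
      ‖a‖ / (a * conj b).re * normLpOn Ω 2 (fun x => F₁ x - F₂ x) := by
  have h := h₁.difference_estimate hm0 hm1 (c := conj a) (δ := (a * conj b).re) h₂ hF₁ hF₂ hF
    (by simpa using ha) (ae_of_all _ fun x => by
      rw [re_conj_mul_zeroOrder]
      have := mul_nonneg (sq_nonneg ‖a‖)
        (re_singularPower_sub_mul_conj_nonneg hm0 hm1 (u₁ x) (u₂ x))
      linarith)
  rw [RCLike.norm_conj] at h
  rwa [div_mul_eq_mul_div, le_div_iff₀ hab, mul_comm]

theorem norm_sub_le_of_coeff_eq_zero (hm0 : 0 < m) (hm1 : m < 1)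
    (h₁ : IsGlobalWeakSolution Ω m 0 b F₁ u₁) (h₂ : IsGlobalWeakSolution Ω m 0 b F₂ u₂)
    (hF₁ : MemLpLocOn Ω 1 F₁) (hF₂ : MemLpLocOn Ω 1 F₂)
    (hF : MemLpOn Ω 2 (fun x => F₁ x - F₂ x)) (hb : b ∈ setA) :
    normLpOn Ω 2 (fun x => u₁ x - u₂ x) ≤
      1 / bZero b * normLpOn Ω 2 (fun x => F₁ x - F₂ x) := by
  -- If $\operatorname{Re}b\ne0$, $c=\pm1$ cancels the gradient term; if $\operatorname{Re}b=0$,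
  -- $c=-i$ keeps it with sign $+1$, and $b\in\mathbb{A}$ forces $\operatorname{Im}b>0$.
  suffices h : ∃ c : ℂ, ‖c‖ = 1 ∧ 0 ≤ (c * Complex.I).re ∧ (c * b).re = bZero b ∧ 0 < bZero b by
    obtain ⟨c, hc, hcI, hcb, hpos⟩ := h
    have h := h₁.difference_estimate hm0 hm1 (c := c) (δ := bZero b) h₂ hF₁ hF₂ hF hcI
      (ae_of_all _ fun x => le_of_eq (by
        rw [zero_mul, zero_add, mul_assoc b, Complex.mul_conj, ← mul_assoc, Complex.re_mul_ofReal,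
          hcb, Complex.normSq_eq_norm_sq]))
    rw [hc, one_mul] at h
    rwa [div_mul_eq_mul_div, le_div_iff₀ hpos, one_mul, mul_comm]
  rcases lt_trichotomy b.re 0 with h | h | h
  · exact ⟨-1, by simp, by simp, by simp [bZero, h.ne, abs_of_neg h], by simp [bZero, h.ne]⟩
  · have him : 0 < b.im := by
      by_contra hle
      exact hb ⟨h, not_lt.1 hle⟩
    exact ⟨-Complex.I, by simp, by simp, by simp [bZero, h], by simpa [bZero, h] using him⟩
  · exact ⟨1, by simp, by simp, by simp [bZero, h.ne', abs_of_pos h], by simp [bZero, h.ne']⟩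

theorem norm_sub_le_of_memLp_top (hm0 : 0 < m) (hm1 : m < 1)
    (h₁ : IsGlobalWeakSolution Ω m a b F₁ u₁) (h₂ : IsGlobalWeakSolution Ω m a b F₂ u₂)
    (hF₁ : MemLpLocOn Ω 1 F₁) (hF₂ : MemLpLocOn Ω 1 F₂)
    (hF : MemLpOn Ω 2 (fun x => F₁ x - F₂ x)) (ha0 : a ≠ 0) (ha : 0 ≤ a.im)
    (hab : (a * conj b).re = 0) (hu₁ : MemLpOn Ω ∞ u₁) (hu₂ : MemLpOn Ω ∞ u₂) :
    normLpOn Ω 2 (fun x => u₁ x - u₂ x) ≤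
      1 / m * ((normLpOn Ω ∞ u₁ + normLpOn Ω ∞ u₂) ^ (1 - m) / ‖a‖) *
        normLpOn Ω 2 (fun x => F₁ x - F₂ x) := by
  have hb₁ : ∀ᵐ x ∂volume.restrict (Ω : Set (Space N)), ‖u₁ x‖ ≤ normLpOn Ω ∞ u₁ :=
    ae_le_lpNorm_exponent_top hu₁
  have hb₂ : ∀ᵐ x ∂volume.restrict (Ω : Set (Space N)), ‖u₂ x‖ ≤ normLpOn Ω ∞ u₂ :=
    ae_le_lpNorm_exponent_top hu₂
  have hM : 0 ≤ normLpOn Ω ∞ u₁ + normLpOn Ω ∞ u₂ := add_nonneg lpNorm_nonneg lpNorm_nonneg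
  set M := normLpOn Ω ∞ u₁ + normLpOn Ω ∞ u₂
  have hna : 0 < ‖a‖ := norm_pos_iff.2 ha0
  rcases hM.eq_or_lt with hM0 | hMpos
  · have hzero : (fun x => u₁ x - u₂ x) =ᵐ[volume.restrict (Ω : Set (Space N))] 0 := by
      filter_upwards [hb₁, hb₂] with x hx₁ hx₂
      have e₁ : u₁ x = 0 := norm_le_zero_iff.1 (by linarith [norm_nonneg (u₂ x)])
      have e₂ : u₂ x = 0 := norm_le_zero_iff.1 (by linarith [norm_nonneg (u₁ x)])
      simp [e₁, e₂]
    have hn : normLpOn Ω 2 (fun x => u₁ x - u₂ x) = 0 :=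
      (lpNorm_eq_zero (h₁.2.1.1.sub h₂.2.1.1) (by norm_num)).2 hzero
    rw [hn]
    exact mul_nonneg (by positivity) lpNorm_nonneg
  · have hS : 0 < M ^ (1 - m) := Real.rpow_pos_of_pos hMpos _
    -- Since $|u_1|+|u_2|\le M$ almost everywhere, the monotonicity factor is at least $m/M^{1-m}$;
    -- then $|a|/\delta=M^{1-m}/(m|a|)$.
    have h := h₁.difference_estimate hm0 hm1 (c := conj a) (δ := ‖a‖ ^ 2 * (m / M ^ (1 - m))) h₂
      hF₁ hF₂ hF (by simpa using ha) (by
        filter_upwards [hb₁, hb₂] with x hx₁ hx₂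
        rw [re_conj_mul_zeroOrder, hab, zero_mul, add_zero, mul_assoc]
        refine mul_le_mul_of_nonneg_left ?_ (sq_nonneg _)
        rw [div_mul_eq_mul_div, div_le_iff₀ hS, mul_comm _ (M ^ (1 - m))]
        refine (singularPower_monotone hm0 hm1 (u₁ x) (u₂ x)).trans
          (mul_le_mul_of_nonneg_right ?_ (re_singularPower_sub_mul_conj_nonneg hm0 hm1 _ _))
        exact Real.rpow_le_rpow (by positivity) (add_le_add hx₁ hx₂) (by linarith))
    rw [RCLike.norm_conj] at h
    have hδ : 0 < ‖a‖ ^ 2 * (m / M ^ (1 - m)) := by positivity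
    refine le_of_mul_le_mul_left (h.trans_eq ?_) hδ
    field_simp

end Uniqueness

end StationaryNLS

theorem theorem5p1 (N : ℕ) (hN : 1 ≤ N) :
    ∃ C : ℝ → ℝ, ContinuousOn C (Set.Ioo 0 1) ∧
      ∀ m : ℝ, 0 < m → m < 1 → 0 < C m ∧
        ∀ (Ω : TopologicalSpace.Opens (StationaryNLS.Space N)),
          (Ω : Set (StationaryNLS.Space N)).Nonempty →
        ∀ a b : ℂ, (a, b) ≠ (0, 0) → StationaryNLS.UniquenessAssumption a b →
        ∀ F₁ F₂ : StationaryNLS.Space N → ℂ,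
          StationaryNLS.MemLpLocOn Ω 1 F₁ → StationaryNLS.MemLpLocOn Ω 1 F₂ →
          StationaryNLS.MemLpOn Ω 2 (fun x => F₁ x - F₂ x) →
        ∀ u₁ u₂ : StationaryNLS.Space N → ℂ,
          StationaryNLS.IsGlobalWeakSolution Ω m a b F₁ u₁ →
          StationaryNLS.IsGlobalWeakSolution Ω m a b F₂ u₂ →
          (a ≠ 0 → 0 < (a * conj b).re →
            StationaryNLS.normLpOn Ω 2 (fun x => u₁ x - u₂ x) ≤
              ‖a‖ / (a * conj b).re * StationaryNLS.normLpOn Ω 2 (fun x => F₁ x - F₂ x)) ∧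
          (a = 0 →
            StationaryNLS.normLpOn Ω 2 (fun x => u₁ x - u₂ x) ≤
              1 / StationaryNLS.bZero b * StationaryNLS.normLpOn Ω 2 (fun x => F₁ x - F₂ x)) ∧
          (a ≠ 0 → (a * conj b).re = 0 →
            StationaryNLS.MemLpOn Ω ∞ u₁ → StationaryNLS.MemLpOn Ω ∞ u₂ →
            StationaryNLS.normLpOn Ω 2 (fun x => u₁ x - u₂ x) ≤
              C m *
                ((StationaryNLS.normLpOn Ω ∞ u₁ + StationaryNLS.normLpOn Ω ∞ u₂) ^ (1 - m) / ‖a‖) *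
                StationaryNLS.normLpOn Ω 2 (fun x => F₁ x - F₂ x)) := by

  -- $C=1/m$ is the inverse of the monotonicity constant.
  refine ⟨fun m => 1 / m, continuousOn_const.div continuousOn_id fun m hm => hm.1.ne', ?_⟩
  intro m hm0 hm1
  refine ⟨one_div_pos.2 hm0, ?_⟩
  intro Ω _ a b hab0 hab F₁ F₂ hF₁ hF₂ hF u₁ u₂ h₁ h₂
  refine ⟨fun _ hpos => ?_, fun ha => ?_, fun ha hre hu₁ hu₂ => ?_⟩
  · exact StationaryNLS.norm_sub_le_of_re_mul_conj_pos hm0 hm1 h₁ h₂ hF₁ hF₂ hF hab.1 hpos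
  · subst ha
    have hb0 : b ≠ 0 := fun h => hab0 (by rw [h])
    have hb : b ∈ StationaryNLS.setA := by
      rcases hab.2 with h | h
      · exact absurd rfl h.1
      · exact h.2.resolve_right hb0
    exact StationaryNLS.norm_sub_le_of_coeff_eq_zero hm0 hm1 h₁ h₂ hF₁ hF₂ hF hb
  · exact StationaryNLS.norm_sub_le_of_memLp_top hm0 hm1 h₁ h₂ hF₁ hF₂ hF ha hab.1 hre hu₁ hu₂
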